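/- Let $A$ and $B$ be complex C*-algebras, not necessarily unital, and suppose that $A$ is an AF algebra, i.e. there is an increasing sequence $A_1\subseteq A_2\subseteq\cdots$ of finite-dimensional C*-subalgebras of $A$ whose union is dense in $A$. Let $\varphi\colon A\to B$ be a *-homomorphism, and let $\mathrm{K}_0(\varphi)\colon \mathrm{K}_0(A)\to \mathrm{K}_0(B)$ be the induced group homomorphism. If $\mathrm{K}_0(\varphi)$ is injective, then $\varphi$ is injective. If $\varphi$ is surjective, then $\mathrm{K}_0(\varphi)$ is surjective. Here, for a unital C*-algebra $D$, $\mathrm{K}_{00}(D)$ is the Grothendieck group of the abelian monoid of Murray–von Neumann equivalence classes of projections in matrix algebras over $D$ (where $p\sim q$ if $p=v^*v$ and $q=vv^*$ for some rectangular matrix $v$ over $D$), with addition induced by the block-diagonal sum. For an arbitrary C*-algebra $A$, let $A^\sim=\mathbb{C}\oplus A$ be its unitization (with a new unit adjoined even if $A$ is unital) and $\pi\colon A^\sim\to\mathbb{C}$, $(z,a)\mapsto z$. Then $\mathrm{K}_0(A)=\ker\big(\mathrm{K}_{00}(\pi)\colon \mathrm{K}_{00}(A^\sim)\to \mathrm{K}_{00}(\mathbb{C})\big)$,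 and $\mathrm{K}_0(\varphi)$ is the restriction to $\mathrm{K}_0(A)$ of the map $\mathrm{K}_{00}(A^\sim)\to \mathrm{K}_{00}(B^\sim)$ induced by the unital extension $\varphi^\sim\colon A^\sim\to B^\sim$ of $\varphi$; in particular $\mathrm{K}_0(\varphi)([p]_0)=[\varphi(p)]_0$ for every projection $p$ in a matrix algebra over $A$. -/

import Mathlib

/-- A (complex, possibly non-unital) C*-algebra `A` is an AF algebra if it has an increasing
sequence of finite-dimensional C*-subalgebras with dense union. (A finite-dimensional
*-subalgebra is automatically closed, hence a C*-subalgebra.) -/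
def IsAFAlgebra (A : Type*) [NonUnitalCStarAlgebra A] : Prop :=
  ∃ F : ℕ → NonUnitalStarSubalgebra ℂ A,
    Monotone F ∧ (∀ n, FiniteDimensional ℂ (F n)) ∧ Dense (⋃ n, (F n : Set A))

namespace KTheory

open Matrix

section MurrayVonNeumann

/-- Murray-von Neumann equivalence of projections in matrix algebras of possibly different sizes:
`p = v* v` and `q = v v*` for some rectangular matrix `v`. -/
def MvN {R : Type*} [NonUnitalRing R] [StarRing R] {m n : Type*} [Fintype m] [Fintype n]
    (p : Matrix m m R) (q : Matrix n n R) : Prop :=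
  ∃ v : Matrix n m R, p = vᴴ * v ∧ q = v * vᴴ

variable {R : Type*} [NonUnitalRing R] [StarRing R]

theorem MvN.symm {m n : Type*} [Fintype m] [Fintype n]
    {p : Matrix m m R} {q : Matrix n n R} (h : MvN p q) : MvN q p := by
  obtain ⟨v, hp, hq⟩ := h
  exact ⟨vᴴ, by simpa using hq, by simpa using hp⟩

theorem MvN.trans {l m n : Type*} [Fintype l] [Fintype m] [Fintype n]
    {p : Matrix l l R} {q : Matrix m m R} {r : Matrix n n R}
    (hp : IsStarProjection p) (hr : IsStarProjection r)
    (h₁ : MvN p q) (h₂ : MvN q r) : MvN p r := by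
  obtain ⟨v, hv₁, hv₂⟩ := h₁
  obtain ⟨w, hw₁, hw₂⟩ := h₂
  refine ⟨w * v, ?_, ?_⟩
  · have h : p = vᴴ * (v * vᴴ) * v := by
      calc p = p * p := hp.isIdempotentElem.eq.symm
        _ = vᴴ * (v * vᴴ) * v := by rw [hv₁]; simp only [Matrix.mul_assoc]
    rw [h, ← hv₂, hw₁, conjTranspose_mul]
    simp only [Matrix.mul_assoc]
  · have h : r = w * (wᴴ * w) * wᴴ := by
      calc r = r * r := hr.isIdempotentElem.eq.symm
        _ = w * (wᴴ * w) * wᴴ := by rw [hw₂]; simp only [Matrix.mul_assoc]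
    rw [h, ← hw₁, hv₂, conjTranspose_mul]
    simp only [Matrix.mul_assoc]

theorem MvN.reindex {m n : Type*} [Fintype m] [Fintype n] (e : m ≃ n)
    {p : Matrix m m R} (hp : IsStarProjection p) : MvN p (Matrix.reindex e e p) := by
  have hs : pᴴ = p := hp.isSelfAdjoint.star_eq
  have hi : p * p = p := hp.isIdempotentElem.eq
  refine ⟨p.submatrix e.symm id, ?_, ?_⟩
  · rw [conjTranspose_submatrix, hs, submatrix_mul_equiv, hi, submatrix_id_id]
  · rw [conjTranspose_submatrix, hs, reindex_apply]
    have := submatrix_mul_equiv p p e.symm (Equiv.refl m) e.symm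
    rw [hi] at this
    exact this.symm

theorem MvN.refl {m : Type*} [Fintype m]
    {p : Matrix m m R} (hp : IsStarProjection p) : MvN p p := by
  simpa using MvN.reindex (Equiv.refl m) hp

theorem isStarProjection_reindex {m n : Type*} [Fintype m] [Fintype n] (e : m ≃ n)
    {p : Matrix m m R} (hp : IsStarProjection p) : IsStarProjection (Matrix.reindex e e p) := by
  constructor
  · have := submatrix_mul_equiv p p e.symm e.symm e.symm
    rw [hp.isIdempotentElem.eq] at this
    exact this
  · change (p.submatrix e.symm e.symm)ᴴ = p.submatrix e.symm e.symm
    rw [conjTranspose_submatrix]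
    exact congrArg (fun x => submatrix x e.symm e.symm) hp.isSelfAdjoint.star_eq

theorem isStarProjection_fromBlocks {m n : Type*} [Fintype m] [Fintype n]
    {p : Matrix m m R} {q : Matrix n n R} (hp : IsStarProjection p) (hq : IsStarProjection q) :
    IsStarProjection (fromBlocks p 0 0 q) := by
  constructor
  · simp [IsIdempotentElem, fromBlocks_multiply, hp.isIdempotentElem.eq, hq.isIdempotentElem.eq]
  · change (fromBlocks p 0 0 q)ᴴ = _
    have h₁ : pᴴ = p := hp.isSelfAdjoint.star_eq
    have h₂ : qᴴ = q := hq.isSelfAdjoint.star_eq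
    simp [fromBlocks_conjTranspose, h₁, h₂]

theorem MvN.fromBlocks {m n m' n' : Type*} [Fintype m] [Fintype n] [Fintype m'] [Fintype n']
    {p : Matrix m m R} {q : Matrix n n R} {p' : Matrix m' m' R} {q' : Matrix n' n' R}
    (h : MvN p p') (h' : MvN q q') :
    MvN (Matrix.fromBlocks p 0 0 q) (Matrix.fromBlocks p' 0 0 q') := by
  obtain ⟨v, rfl, rfl⟩ := h
  obtain ⟨w, rfl, rfl⟩ := h'
  exact ⟨Matrix.fromBlocks v 0 0 w, by simp [fromBlocks_conjTranspose, fromBlocks_multiply],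
    by simp [fromBlocks_conjTranspose, fromBlocks_multiply]⟩

end MurrayVonNeumann

/-- Projections in the matrix algebras `M_n(R)`, `n = 0, 1, 2, …`. (The `0 × 0` projection
is Murray-von Neumann equivalent to the zero projection of any size, so it adds no new class.) -/
structure Proj (R : Type*) [NonUnitalRing R] [StarRing R] where
  /-- the size of the matrix -/
  size : ℕ
  /-- the matrix -/
  mat : Matrix (Fin size) (Fin size) R
  isStarProjection : IsStarProjection mat

section Semigroup

variable {R S : Type*} [NonUnitalRing R] [StarRing R] [NonUnitalRing S] [StarRing S]

/-- The block-diagonal sum `p ⊕ q` of projections. -/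
def Proj.oplus (p q : Proj R) : Proj R where
  size := p.size + q.size
  mat := Matrix.reindex finSumFinEquiv finSumFinEquiv (Matrix.fromBlocks p.mat 0 0 q.mat)
  isStarProjection := isStarProjection_reindex _
    (isStarProjection_fromBlocks p.isStarProjection q.isStarProjection)

theorem Proj.mvN_oplus (p q : Proj R) :
    MvN (Matrix.fromBlocks p.mat 0 0 q.mat) (p.oplus q).mat :=
  MvN.reindex _ (isStarProjection_fromBlocks p.isStarProjection q.isStarProjection)

/-- The image of a projection under a *-homomorphism, applied entrywise. -/
def Proj.map {F : Type*} [FunLike F R S] [NonUnitalRingHomClass F R S] [StarHomClass F R S]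
    (f : F) (p : Proj R) : Proj S where
  size := p.size
  mat := p.mat.map f
  isStarProjection := by
    constructor
    · have h := congrArg (fun x => Matrix.map x f) p.isStarProjection.isIdempotentElem.eq
      rw [IsIdempotentElem]
      ext i j
      have := congrFun (congrFun h i) j
      simpa [Matrix.mul_apply] using this
    · have h := congrArg (fun x => Matrix.map x f) p.isStarProjection.isSelfAdjoint.star_eq
      ext i j
      have := congrFun (congrFun h i) j
      simpa [Matrix.star_apply, map_star] using this

instance projSetoid (R : Type*) [NonUnitalRing R] [StarRing R] : Setoid (Proj R) where
  r p q := MvN p.mat q.mat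
  iseqv :=
    ⟨fun p => MvN.refl p.isStarProjection, fun h => h.symm,
      fun {p _ r} h₁ h₂ => MvN.trans p.isStarProjection r.isStarProjection h₁ h₂⟩

/-- The semigroup of Murray-von Neumann classes of projections in matrices over `R`. -/
def V (R : Type*) [NonUnitalRing R] [StarRing R] : Type _ := Quotient (projSetoid R)

/-- The class of a projection. -/
def V.mk (p : Proj R) : V R := Quotient.mk _ p

theorem V.sound {p q : Proj R} (h : MvN p.mat q.mat) : V.mk p = V.mk q := Quotient.sound h

theorem Proj.oplus_congr {p q p' q' : Proj R} (h : MvN p.mat p'.mat) (h' : MvN q.mat q'.mat) :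
    MvN (p.oplus q).mat (p'.oplus q').mat :=
  have P := isStarProjection_fromBlocks p.isStarProjection q.isStarProjection
  have Q := (p'.oplus q').isStarProjection
  (p.mvN_oplus q).symm.trans (p.oplus q).isStarProjection Q
    ((h.fromBlocks h').trans P Q (p'.mvN_oplus q'))

theorem mvN_of_reindex {m n : Type*} [Fintype m] [Fintype n] (e : m ≃ n)
    {p : Matrix m m R} {q : Matrix n n R} (hp : IsStarProjection p)
    (h : Matrix.reindex e e p = q) : MvN p q := h ▸ MvN.reindex e hp

theorem Proj.oplus_comm (p q : Proj R) : MvN (p.oplus q).mat (q.oplus p).mat := by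
  have hpq := isStarProjection_fromBlocks p.isStarProjection q.isStarProjection
  have h : MvN (Matrix.fromBlocks p.mat 0 0 q.mat) (Matrix.fromBlocks q.mat 0 0 p.mat) := by
    refine mvN_of_reindex (Equiv.sumComm _ _) hpq ?_
    ext i j
    rcases i with i | i <;> rcases j with j | j <;> rfl
  exact (p.mvN_oplus q).symm.trans (p.oplus q).isStarProjection (q.oplus p).isStarProjection
    (h.trans hpq (q.oplus p).isStarProjection (q.mvN_oplus p))

theorem Proj.oplus_assoc (p q r : Proj R) :
    MvN ((p.oplus q).oplus r).mat (p.oplus (q.oplus r)).mat := by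
  have hp := p.isStarProjection
  have hq := q.isStarProjection
  have hr := r.isStarProjection
  have h₁ := isStarProjection_fromBlocks (isStarProjection_fromBlocks hp hq) hr
  have h₂ := isStarProjection_fromBlocks hp (isStarProjection_fromBlocks hq hr)
  have hL := ((p.oplus q).oplus r).isStarProjection
  have hR := (p.oplus (q.oplus r)).isStarProjection
  have a₁ : MvN (Matrix.fromBlocks (Matrix.fromBlocks p.mat 0 0 q.mat) 0 0 r.mat)
      ((p.oplus q).oplus r).mat :=
    (MvN.fromBlocks (p.mvN_oplus q) (MvN.refl hr)).trans h₁ hL ((p.oplus q).mvN_oplus r)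
  have a₂ : MvN (Matrix.fromBlocks p.mat 0 0 (Matrix.fromBlocks q.mat 0 0 r.mat))
      (p.oplus (q.oplus r)).mat :=
    (MvN.fromBlocks (MvN.refl hp) (q.mvN_oplus r)).trans h₂ hR (p.mvN_oplus (q.oplus r))
  have h : MvN (Matrix.fromBlocks (Matrix.fromBlocks p.mat 0 0 q.mat) 0 0 r.mat)
      (Matrix.fromBlocks p.mat 0 0 (Matrix.fromBlocks q.mat 0 0 r.mat)) := by
    refine mvN_of_reindex (Equiv.sumAssoc _ _ _) h₁ ?_
    ext i j
    rcases i with i | i | i <;> rcases j with j | j | j <;> rfl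
  exact a₁.symm.trans hL hR (h.trans h₁ hR a₂)

/-- The projection of size zero. -/
def Proj.zero (R : Type*) [NonUnitalRing R] [StarRing R] : Proj R where
  size := 0
  mat := 0
  isStarProjection := IsStarProjection.zero _

theorem Proj.zero_oplus (p : Proj R) : MvN ((Proj.zero R).oplus p).mat p.mat := by
  have hp := p.isStarProjection
  have h₀ := isStarProjection_fromBlocks (Proj.zero R).isStarProjection hp
  refine ((Proj.zero R).mvN_oplus p).symm.trans ((Proj.zero R).oplus p).isStarProjection hp ?_
  have : IsEmpty (Fin (Proj.zero R).size) := inferInstanceAs (IsEmpty (Fin 0))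
  refine mvN_of_reindex (Equiv.emptySum _ _) h₀ ?_
  ext i j
  rfl

/-- Addition of classes is induced by the block-diagonal sum. -/
instance : Add (V R) where
  add := Quotient.map₂ Proj.oplus fun _ _ h _ _ h' => Proj.oplus_congr h h'

instance : Zero (V R) where
  zero := V.mk (Proj.zero R)

theorem V.mk_add_mk (p q : Proj R) : V.mk p + V.mk q = V.mk (p.oplus q) := rfl

instance : AddCommMonoid (V R) where
  add_assoc := by
    rintro ⟨p⟩ ⟨q⟩ ⟨r⟩
    exact V.sound (Proj.oplus_assoc p q r)
  zero_add := by
    rintro ⟨p⟩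
    exact V.sound (Proj.zero_oplus p)
  add_zero := by
    rintro ⟨p⟩
    exact V.sound ((Proj.oplus_comm p (Proj.zero R)).trans (p.oplus (Proj.zero R)).isStarProjection
      p.isStarProjection (Proj.zero_oplus p))
  add_comm := by
    rintro ⟨p⟩ ⟨q⟩
    exact V.sound (Proj.oplus_comm p q)
  nsmul := nsmulRec

section Functoriality

variable {F : Type*} [FunLike F R S] [NonUnitalRingHomClass F R S] [StarHomClass F R S]

theorem MvN.map (f : F) {m n : Type*} [Fintype m] [Fintype n]
    {p : Matrix m m R} {q : Matrix n n R} (h : MvN p q) : MvN (p.map f) (q.map f) := by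
  obtain ⟨v, rfl, rfl⟩ := h
  refine ⟨v.map f, ?_, ?_⟩ <;> ext i j <;> simp [Matrix.mul_apply, map_star]

theorem Proj.map_oplus (f : F) (p q : Proj R) :
    MvN ((p.oplus q).map f).mat ((p.map f).oplus (q.map f)).mat := by
  have h := (MvN.map f (p.mvN_oplus q)).symm
  refine h.trans ((p.oplus q).map f).isStarProjection
    ((p.map f).oplus (q.map f)).isStarProjection ?_
  have e : (Matrix.fromBlocks p.mat 0 0 q.mat).map f =
      Matrix.fromBlocks (p.mat.map f) 0 0 (q.mat.map f) := by
    rw [fromBlocks_map]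
    simp
  rw [e]
  exact (p.map f).mvN_oplus (q.map f)

/-- The homomorphism `V(f) : V(R) → V(S)`, `[p] ↦ [f(p)]`, induced by a *-homomorphism `f`. -/
def V.map (f : F) : V R →+ V S where
  toFun := Quotient.map (Proj.map f) fun _ _ h => MvN.map f h
  map_zero' := V.sound (by
    have h : ((Proj.zero R).map f).mat = (Proj.zero S).mat := by
      ext i
      exact i.elim0
    rw [h]
    exact MvN.refl (Proj.zero S).isStarProjection)
  map_add' := by
    rintro ⟨p⟩ ⟨q⟩
    exact V.sound (Proj.map_oplus f p q)

theorem V.map_mk (f : F) (p : Proj R) : V.map f (V.mk p) = V.mk (p.map f) := rfl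

end Functoriality

end Semigroup

noncomputable section

/-- The Grothendieck group `K₀₀(R)` of the semigroup `V(R)`. For a unital C*-algebra this is the
group of formal differences `[p] - [q]` of classes of projections in matrices over `R`. -/
abbrev K00 (R : Type*) [NonUnitalRing R] [StarRing R] : Type _ :=
  Algebra.GrothendieckAddGroup (V R)

/-- The homomorphism `K₀₀(f) : K₀₀(R) → K₀₀(S)`, `[p] - [q] ↦ [f(p)] - [f(q)]`. -/
def K00.map {R S F : Type*} [NonUnitalRing R] [StarRing R] [NonUnitalRing S] [StarRing S]
    [FunLike F R S] [NonUnitalRingHomClass F R S] [StarHomClass F R S] (f : F) :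
    K00 R →+ K00 S :=
  Algebra.GrothendieckAddGroup.lift ((Algebra.GrothendieckAddGroup.of (M := V S)).comp (V.map f))

/-- The scalar character `π : A~ → ℂ`, `(z, a) ↦ z`, of the unitization of `A`. -/
def scalarHom (A : Type*) [NonUnitalCStarAlgebra A] : Unitization ℂ A →⋆ₐ[ℂ] ℂ where
  __ := Unitization.fstHom ℂ A
  map_star' _ := rfl

/-- The group `K₀(A)` of a (possibly non-unital) C*-algebra `A`: the kernel of
`K₀₀(π) : K₀₀(A~) → K₀₀(ℂ)`, where `A~ = ℂ ⊕ A` is the unitization and `π : A~ → ℂ`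
its scalar character. -/
def K0 (A : Type*) [NonUnitalCStarAlgebra A] : AddSubgroup (K00 (Unitization ℂ A)) :=
  (K00.map (scalarHom A)).ker

theorem K00.map_of {R S F : Type*} [NonUnitalRing R] [StarRing R] [NonUnitalRing S] [StarRing S]
    [FunLike F R S] [NonUnitalRingHomClass F R S] [StarHomClass F R S] (f : F) (v : V R) :
    K00.map f (Algebra.GrothendieckAddGroup.of v) = Algebra.GrothendieckAddGroup.of (V.map f v) :=
  DFunLike.congr_fun (Algebra.GrothendieckAddGroup.lift.symm_apply_apply
    ((Algebra.GrothendieckAddGroup.of (M := V S)).comp (V.map f))) v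

theorem K00.map_comp_apply {R S T F G H : Type*} [NonUnitalRing R] [StarRing R]
    [NonUnitalRing S] [StarRing S] [NonUnitalRing T] [StarRing T]
    [FunLike F R S] [NonUnitalRingHomClass F R S] [StarHomClass F R S]
    [FunLike G S T] [NonUnitalRingHomClass G S T] [StarHomClass G S T]
    [FunLike H R T] [NonUnitalRingHomClass H R T] [StarHomClass H R T]
    (f : F) (g : G) (h : H) (hh : ∀ x, g (f x) = h x) (x : K00 R) :
    K00.map g (K00.map f x) = K00.map h x := by
  have key (v : V R) : V.map g (V.map f v) = V.map h v := by
    obtain ⟨p⟩ := v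
    change V.mk ((p.map f).map g) = V.mk (p.map h)
    have hp : (p.map f).map g = p.map h := by
      simp only [Proj.map, Proj.mk.injEq, heq_eq_eq, true_and]
      ext i j
      exact hh _
    rw [hp]
  suffices e : (K00.map g).comp (K00.map f) = K00.map h from DFunLike.congr_fun e x
  refine Algebra.GrothendieckAddGroup.lift.symm.injective ?_
  ext v
  simp only [Algebra.GrothendieckAddGroup.lift_symm_apply, AddMonoidHom.comp_apply, K00.map_of, key]

/-- The homomorphism `K₀(φ) : K₀(A) → K₀(B)` induced by a *-homomorphism `φ : A → B`: the
restriction of `K₀₀(φ~)`, where `φ~ : A~ → B~` is the unital extension of `φ`. -/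
def K0.map {A B : Type*} [NonUnitalCStarAlgebra A] [NonUnitalCStarAlgebra B]
    (φ : A →⋆ₙₐ[ℂ] B) : K0 A →+ K0 B :=
  ((K00.map (Unitization.starMap φ)).domRestrict (K0 A)).codRestrict (K0 B) fun x => by
    change K00.map (scalarHom B) (K00.map (Unitization.starMap φ) x.1) = 0
    rw [K00.map_comp_apply (Unitization.starMap φ) (scalarHom B) (scalarHom A) (fun y => by
      change (Unitization.starMap φ y).fst = y.fst
      induction y using Unitization.ind with
      | inl_add_inr r a => simp [Unitization.algebraMap_eq_inl])]
    exact x.2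

/-- The class `[p]₀ ∈ K₀(A)` of a projection `p` in a matrix algebra over `A`. -/
def K0.mk {A : Type*} [NonUnitalCStarAlgebra A] (p : Proj A) : K0 A :=
  ⟨Algebra.GrothendieckAddGroup.of (V.mk (p.map (Unitization.inrNonUnitalStarAlgHom ℂ A))), by
    change K00.map _ _ = 0
    rw [K00.map_of, V.map_mk]
    have h : V.mk ((p.map (Unitization.inrNonUnitalStarAlgHom ℂ A)).map (scalarHom A)) = 0 := by
      refine V.sound ⟨0, ?_, ?_⟩
      · ext i j
        exact (zero_apply i j).symm.trans (by rw [Matrix.mul_zero])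
      · ext i
        exact i.elim0
    rw [h, map_zero]⟩

/-- `K₀(φ)([p]₀) = [φ(p)]₀`. -/
theorem K0.map_mk {A B : Type*} [NonUnitalCStarAlgebra A] [NonUnitalCStarAlgebra B]
    (φ : A →⋆ₙₐ[ℂ] B) (p : Proj A) : K0.map φ (K0.mk p) = K0.mk (p.map φ) := by
  apply Subtype.ext
  change K00.map (Unitization.starMap φ) (Algebra.GrothendieckAddGroup.of _) = _
  rw [K00.map_of, V.map_mk]
  have h : (p.map (Unitization.inrNonUnitalStarAlgHom ℂ A)).map (Unitization.starMap φ) =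
      (p.map φ).map (Unitization.inrNonUnitalStarAlgHom ℂ B) := by
    simp only [Proj.map, Proj.mk.injEq, heq_eq_eq, true_and]
    ext i j <;> simp
  rw [h]
  rfl

end

end KTheory

/-! Both halves rest on one density fact, `IsAFAlgebra.dense_finiteDimensionalElements`: in a matrix
algebra over `A~`, the elements lying in finite-dimensional unital *-subalgebras are dense. Such
elements have finite spectrum, so a step function of a self-adjoint one is a projection.

Injectivity, by contraposition. If `φ` is not injective, cutting off the spectrum of an approximant
to a positive element of the kernel gives a nonzero projection `e` with `φ e = 0`, so `K₀(φ)[e]₀ =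
0`. But `[e]₀ ≠ 0`: a vanishing class gives `e ⊕ r ~ r` for some `r`, hence a non-unitary isometry
in a matrix algebra over `A~`. Density forbids this, since finite-dimensional algebras have none and
invertibility is an open condition.

Surjectivity. For `φ` onto, lift a projection `q` over `B~` to some matrix over `A~`, approximate it
by a self-adjoint matrix of finite spectrum, and take a spectral projection `p`. Its image is at
distance less than one from `q`, hence equivalent to `q`. Applied to both terms of a formal
difference, this lifts every class. -/

/-! ### Projections and isometries in unital C*-algebras -/

section CStarAlgebra

variable {D E : Type*} [CStarAlgebra D] [CStarAlgebra E]

/-- Two projections at distance less than one in a C*-algebra are Murray-von Neumann equivalent. -/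
theorem IsStarProjection.exists_star_mul_self_eq_of_norm_sub_lt_one {p q : D}
    (hp : IsStarProjection p) (hq : IsStarProjection q) (h : ‖p - q‖ < 1) :
    ∃ v : D, p = star v * v ∧ q = v * star v := by
  let _ : PartialOrder D := CStarAlgebra.spectralOrder D
  have _ : StarOrderedRing D := CStarAlgebra.spectralOrderedRing D
  have hpp : p * p = p := hp.isIdempotentElem.eq
  have hqq : q * q = q := hq.isIdempotentElem.eq
  have hps : star p = p := hp.isSelfAdjoint.star_eq
  have hqs : star q = q := hq.isSelfAdjoint.star_eq
  -- `z` intertwines `p` and `q` and is invertible, being close to 1. Its unitary polar part `u = z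
  -- (z* z)^(-1/2)` then satisfies `u p u* = q`, and `v = u p` is the required partial isometry.
  set z : D := q * p + (1 - q) * (1 - p) with hz
  have hzp : z * p = q * z := by
    rw [hz]
    simp only [add_mul, mul_add, sub_mul, mul_sub, one_mul, mul_one, mul_assoc, hpp]
    simp only [← mul_assoc, hqq]
    abel
  have hzu : IsUnit z := by
    have h1 : 1 - z = (q - (1 - q)) * (q - p) := by
      rw [hz]
      simp only [sub_mul, mul_sub, one_mul, mul_one, hqq]
      abel
    -- `2q - 1` is a self-adjoint unitary; only `≤` is claimed, so that the zero algebra is covered.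
    have h2 : ‖q - (1 - q)‖ ≤ 1 := by
      have hs : star (q - (1 - q)) * (q - (1 - q)) = 1 := by
        simp only [star_sub, star_one, hqs, sub_mul, mul_sub, one_mul, mul_one, hqq]
        abel
      have := CStarRing.norm_star_mul_self (x := q - (1 - q))
      rw [hs] at this
      have h1 : ‖(1 : D)‖ ≤ 1 := IsStarProjection.norm_le _ (.one D)
      nlinarith [norm_nonneg (q - (1 - q))]
    have h3 : ‖1 - z‖ < 1 := by
      rw [h1]
      calc _ ≤ ‖q - (1 - q)‖ * ‖q - p‖ := norm_mul_le _ _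
        _ ≤ 1 * ‖q - p‖ := by gcongr
        _ < 1 := by rwa [one_mul, norm_sub_rev]
    simpa using isUnit_one_sub_of_norm_lt_one h3
  have hzp' : p * star z = star z * q := by
    simpa [hps, hqs] using congrArg star hzp
  set a : D := star z * z with ha
  have hau : IsUnit a := hzu.star.mul hzu
  have ha0 : 0 ≤ a := star_mul_self_nonneg z
  set h : D := a ^ (-(1 / 2) : ℝ) with hh
  have hh0 : 0 ≤ h := CFC.rpow_nonneg
  have hhs : star h = h := hh0.isSelfAdjoint.star_eq
  have hpa : Commute a p := by
    change star z * z * p = p * (star z * z)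
    rw [mul_assoc, hzp, ← mul_assoc, ← hzp', mul_assoc]
  have hph : Commute h p := by
    rw [hh, CFC.rpow_def]
    exact hpa.cfc_nnreal _
  have hah : h * a * h = 1 := by
    rw [hh]
    nth_rw 2 [← CFC.rpow_one a]
    rw [← CFC.rpow_add hau, ← CFC.rpow_add hau]
    norm_num
    exact CFC.rpow_zero a
  have hu : star (z * h) * (z * h) = 1 := by
    rw [star_mul, hhs, ← hah, ha]
    simp only [mul_assoc]
  have hzhu : IsUnit (z * h) := hzu.mul (hau.cfcRpow _)
  have hu' : (z * h) * star (z * h) = 1 := by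
    obtain ⟨u, hu1⟩ := hzhu
    rw [← hu1] at hu ⊢
    rw [eq_comm, Units.inv_eq_of_mul_eq_one_left hu |>.symm]
    simp
  refine ⟨z * h * p, ?_, ?_⟩
  · rw [star_mul, mul_assoc, ← mul_assoc (star (z * h)), hu, one_mul, hps, hpp]
  · rw [star_mul, hps, ← mul_assoc, mul_assoc (z * h), hpp, mul_assoc z, hph.eq, ← mul_assoc z, hzp,
      mul_assoc q, mul_assoc q, hu', mul_one]

/-- Elements of a C*-algebra lying in some finite-dimensional *-subalgebra. -/
def finiteDimensionalElements (D : Type*) [CStarAlgebra D] : Set D :=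
  {x | ∃ S : StarSubalgebra ℂ D, FiniteDimensional ℂ S ∧ x ∈ S}

/-- A monic polynomial annihilates `x`, and by spectral mapping the spectrum lies among its roots.
Finiteness makes every function continuous on the spectrum. -/
theorem finite_spectrum_of_mem_finiteDimensionalElements {x : D}
    (hx : x ∈ finiteDimensionalElements D) : (spectrum ℝ x).Finite := by
  obtain ⟨S, hS, hxS⟩ := hx
  obtain ⟨f, hf, hfx⟩ : IsIntegral ℂ (⟨x, hxS⟩ : S) := IsIntegral.of_finite ℂ _
  have hfx' : Polynomial.aeval x f = 0 := by
    have := congrArg S.subtype hfx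
    rw [map_zero, ← Polynomial.aeval_def, ← Polynomial.aeval_algHom_apply S.subtype] at this
    exact this
  rcases subsingleton_or_nontrivial D with _ | _
  · simp [spectrum.of_subsingleton]
  have hC : (spectrum ℂ x).Finite := by
    refine (f.rootSet_finite ℂ).subset fun k hk => ?_
    have := spectrum.subset_polynomial_aeval x f ⟨k, hk, rfl⟩
    rw [hfx', spectrum.zero_eq] at this
    rw [Polynomial.mem_rootSet]
    exact ⟨hf.ne_zero, by simpa using this⟩
  rw [← spectrum.preimage_algebraMap ℂ]
  exact hC.preimage (Complex.ofReal_injective.injOn)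

/-- In a C*-algebra with a dense union of finite-dimensional subalgebras, isometries
are unitaries. -/
theorem mul_star_self_eq_one_of_dense_finiteDimensionalElements
    (hD : Dense (finiteDimensionalElements D)) {w : D} (hw : star w * w = 1) :
    w * star w = 1 := by
  -- Choose `x` near `w` in a finite-dimensional `S` with `w* x` invertible. Left multiplication by
  -- `x` is injective on `S`, hence surjective, so `x` is invertible; then so is `w*`.
  have hopen : IsOpen {x : D | ‖1 - star w * x‖ < 1} := by
    apply isOpen_lt <;> fun_prop
  obtain ⟨x, hx, S, hS, hxS⟩ := hD.inter_open_nonempty _ hopen ⟨w, by simp [hw]⟩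
  have hwx : IsUnit (star w * x) := by
    simpa using isUnit_one_sub_of_norm_lt_one (show ‖1 - star w * x‖ < 1 from hx)
  have hinj : ∀ y, x * y = 0 → y = 0 := by
    intro y hy
    refine hwx.mul_left_cancel ?_
    rw [mul_assoc, hy, mul_zero, mul_zero]
  have hsurj : Function.Surjective (LinearMap.mulLeft ℂ (⟨x, hxS⟩ : S)) := by
    refine LinearMap.injective_iff_surjective.1 ((injective_iff_map_eq_zero _).2 fun y hy => ?_)
    exact Subtype.ext (hinj y (congrArg Subtype.val hy))
  obtain ⟨y, hy⟩ := hsurj 1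
  have hxy : x * y = 1 := congrArg Subtype.val hy
  have hyx : (y : D) * x = 1 := by
    have : x * (y * x - 1) = 0 := by rw [mul_sub, ← mul_assoc, hxy]; simp
    exact sub_eq_zero.1 (hinj _ this)
  have hxu : IsUnit x := ⟨⟨x, y, hxy, hyx⟩, rfl⟩
  obtain ⟨u, hu⟩ : IsUnit (star w) := by
    have : star w = star w * x * y := by rw [mul_assoc, hxy, mul_one]
    rw [this]
    exact hwx.mul ⟨⟨y, x, hyx, hxy⟩, rfl⟩
  rw [← hu] at hw ⊢
  rw [Units.mul_eq_one_iff_inv_eq] at hw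
  rw [← hw, Units.inv_mul]

/-- If `ψ b` is close to a projection, with `b` self-adjoint of finite spectrum, then the
projection is close to the image under `ψ` of a spectral projection of `b`. -/
theorem exists_isStarProjection_norm_map_sub_lt_one (ψ : D →⋆ₐ[ℂ] E) {b : D} {q : E}
    (hb : IsSelfAdjoint b) (hbf : (spectrum ℝ b).Finite) (hq : IsStarProjection q)
    (hbq : ‖ψ b - q‖ ≤ 1 / 5) : ∃ p : D, IsStarProjection p ∧ ‖ψ p - q‖ < 1 := by
  -- The jump at 1/2 is harmless on a finite spectrum; no gap around 1/2 is needed.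
  let f : ℝ → ℝ := fun x => if 1 / 2 < x then 1 else 0
  have hf : ContinuousOn f (spectrum ℝ b) := hbf.continuousOn f
  have hc : IsSelfAdjoint (ψ b) := hb.map ψ
  have hψ : Continuous ψ := (NonUnitalStarAlgHom.instContinuousLinearMapClassComplex).map_continuous ψ
  have hcf : ContinuousOn f (spectrum ℝ (ψ b)) :=
    hf.mono (AlgHom.spectrum_apply_subset (ψ.restrictScalars ℝ) b)
  refine ⟨cfc f b, ⟨?_, cfc_predicate f b⟩, ?_⟩
  · rw [IsIdempotentElem, ← cfc_mul f f b]
    congr 1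
    ext x
    by_cases hx : 1 / 2 < x <;> simp [f]
  rw [StarAlgHom.map_cfc ψ f b]
  set c := ψ b with hcdef
  have hqq : q * q = q := hq.isIdempotentElem.eq
  -- Three terms of size 1/5 and one of size 1/25 give 16/25. The bound 3/4 is what puts the
  -- spectrum in `[-1/2, 3/2]`, where `|f t - t| ≤ 1/2`; finally `1/2 + 1/5 < 1`.
  have hcc : ‖c * c - c‖ ≤ 3 / 4 := by
    have h1 : c * c - c = q * (c - q) + (c - q) * q + (c - q) * (c - q) - (c - q) := by
      simp only [mul_sub, sub_mul, hqq]
      abel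
    have hq1 : ‖q‖ ≤ 1 := hq.norm_le
    rw [h1]
    set e := c - q
    have h2 : ‖q * e‖ ≤ 1 / 5 := (norm_mul_le _ _).trans (by nlinarith [norm_nonneg e, norm_nonneg q])
    have h3 : ‖e * q‖ ≤ 1 / 5 := (norm_mul_le _ _).trans (by nlinarith [norm_nonneg e, norm_nonneg q])
    have h4 : ‖e * e‖ ≤ 1 / 25 := (norm_mul_le _ _).trans (by nlinarith [norm_nonneg e])
    linarith [norm_sub_le (q * e + e * q + e * e) e, norm_add_le (q * e + e * q) (e * e),
      norm_add_le (q * e) (e * q)]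
  have hcfc : c * c - c = cfc (fun x : ℝ => x * x - x) c := by
    rw [cfc_sub (fun x : ℝ => x * x) (fun x => x) c, cfc_mul (fun x : ℝ => x) (fun x => x) c,
      cfc_id' ℝ c]
  have hfc : ‖cfc f c - c‖ ≤ 1 / 2 := by
    have : cfc f c - c = cfc (fun x => f x - x) c := by
      rw [cfc_sub f (fun x => x) c, cfc_id' ℝ c]
    rw [this]
    refine norm_cfc_le (by norm_num) fun x hx => ?_
    have hx1 : ‖x * x - x‖ ≤ 3 / 4 := by
      refine le_trans ?_ hcc
      rw [hcfc]
      exact norm_apply_le_norm_cfc (fun x : ℝ => x * x - x) c hx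
    rw [Real.norm_eq_abs, abs_le] at hx1 ⊢
    simp only [f]
    split_ifs <;> constructor <;> nlinarith
  calc ‖cfc f c - q‖ = ‖(cfc f c - c) + (c - q)‖ := by congr 1; abel
    _ ≤ _ := norm_add_le _ _
    _ < 1 := by linarith

/-- Projections lift, up to Murray-von Neumann equivalence, along surjections from a C*-algebra
with a dense union of finite-dimensional subalgebras. -/
theorem exists_isStarProjection_map_equiv (hD : Dense (finiteDimensionalElements D))
    (ψ : D →⋆ₐ[ℂ] E) (hψ : Function.Surjective ψ) {q : E} (hq : IsStarProjection q) :
    ∃ p : D, IsStarProjection p ∧ ∃ v : E, ψ p = star v * v ∧ q = v * star v := by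
  obtain ⟨a, ha⟩ := hψ q
  have hψc : Continuous ψ :=
    (NonUnitalStarAlgHom.instContinuousLinearMapClassComplex).map_continuous ψ
  have hopen : IsOpen {x : D | ‖ψ x - q‖ < 1 / 5} := by
    apply isOpen_lt <;> fun_prop
  obtain ⟨x, hx, S, hS, hxS⟩ := hD.inter_open_nonempty _ hopen ⟨a, by simp [ha]⟩
  -- The self-adjoint part of `x` stays in `S`, and its image is no further from the self-adjoint
  -- `q`.
  have hb : ((2⁻¹ : ℂ) • (x + star x)) ∈ finiteDimensionalElements D :=
    ⟨S, hS, SMulMemClass.smul_mem _ (add_mem hxS (star_mem hxS))⟩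
  have hbs : IsSelfAdjoint ((2⁻¹ : ℂ) • (x + star x)) := by
    refine IsSelfAdjoint.smul ?_ (IsSelfAdjoint.add_star_self x)
    simp [IsSelfAdjoint]
  have hbq : ‖ψ ((2⁻¹ : ℂ) • (x + star x)) - q‖ ≤ 1 / 5 := by
    have h1 : ψ ((2⁻¹ : ℂ) • (x + star x)) - q = (2⁻¹ : ℂ) • ((ψ x - q) + star (ψ x - q)) := by
      have h2 : q = (2⁻¹ : ℂ) • (q + q) := by rw [← two_smul ℂ q, smul_smul]; norm_num
      nth_rw 1 [h2]
      rw [map_smul, ← smul_sub, map_add, map_star, star_sub, hq.isSelfAdjoint.star_eq]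
      congr 1
      abel
    have hx' : ‖ψ x - q‖ < 1 / 5 := hx
    have := norm_add_le (ψ x - q) (star (ψ x - q))
    rw [norm_star] at this
    rw [h1, norm_smul, show ‖(2⁻¹ : ℂ)‖ = 1 / 2 by norm_num]
    linarith
  obtain ⟨p, hp, hpq⟩ := exists_isStarProjection_norm_map_sub_lt_one ψ hbs
    (finite_spectrum_of_mem_finiteDimensionalElements hb) hq hbq
  exact ⟨p, hp, (hp.map ψ).exists_star_mul_self_eq_of_norm_sub_lt_one hq hpq⟩

end CStarAlgebra

/-! ### Finite-dimensional approximation in the unitization -/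

section Unitization

variable {A : Type*} [NonUnitalCStarAlgebra A]

/-- The unitization `ℂ ⊕ S ⊆ A~` of a *-subalgebra `S` of `A`. -/
def NonUnitalStarSubalgebra.unitizationSubalgebra (S : NonUnitalStarSubalgebra ℂ A) :
    StarSubalgebra ℂ (Unitization ℂ A) where
  carrier := {x | x.snd ∈ S}
  mul_mem' {x y} hx hy := by
    change (x * y).snd ∈ S
    rw [Unitization.snd_mul]
    exact add_mem (add_mem (SMulMemClass.smul_mem _ hy) (SMulMemClass.smul_mem _ hx))
      (mul_mem hx hy)
  add_mem' hx hy := S.add_mem hx hy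
  algebraMap_mem' r := by simp [Unitization.algebraMap_eq_inl]
  star_mem' hx := star_mem (S := NonUnitalStarSubalgebra ℂ A) hx

instance (S : NonUnitalStarSubalgebra ℂ A) [FiniteDimensional ℂ S] :
    FiniteDimensional ℂ S.unitizationSubalgebra := by
  let f : S.unitizationSubalgebra →ₗ[ℂ] ℂ × S :=
    { toFun x := (x.1.fst, ⟨x.1.snd, x.2⟩)
      map_add' _ _ := rfl
      map_smul' _ _ := rfl }
  refine FiniteDimensional.of_injective f fun x y h => ?_
  have h1 := congrArg Prod.fst h
  have h2 := congrArg (fun z => (z.2 : A)) h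
  exact Subtype.ext (Unitization.ext h1 h2)

/-- Topologically `A~` is `ℂ × A`, and the preimage of a dense set under the open projection to `A`
is dense. -/
theorem dense_iUnion_unitizationSubalgebra {F : ℕ → NonUnitalStarSubalgebra ℂ A}
    (hF : Dense (⋃ n, (F n : Set A))) :
    Dense (⋃ n, ((F n).unitizationSubalgebra : Set (Unitization ℂ A))) := by
  have h := (hF.preimage (isOpenMap_snd (X := ℂ))).preimage
    (Unitization.uniformEquivProd (𝕜 := ℂ) (A := A)).toHomeomorph.isOpenMap
  convert h using 1
  ext x
  simp only [Set.mem_iUnion, Set.mem_preimage]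
  rfl

end Unitization

/-! ### Finite-dimensional approximation in matrix algebras -/

section CStarMatrix

variable {A : Type*} [CStarAlgebra A] {k : Type*} [Fintype k] [DecidableEq k]

/-- The matrices with entries in a *-subalgebra. -/
def StarSubalgebra.cstarMatrix (S : StarSubalgebra ℂ A) (k : Type*) [Fintype k] [DecidableEq k] :
    StarSubalgebra ℂ (CStarMatrix k k A) where
  carrier := {M | ∀ i j, M i j ∈ S}
  mul_mem' {M N} hM hN i j := by
    rw [CStarMatrix.mul_apply]
    exact sum_mem fun l _ => mul_mem (hM i l) (hN l j)
  add_mem' hM hN i j := add_mem (hM i j) (hN i j)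
  algebraMap_mem' r i j := by
    rw [CStarMatrix.algebraMap_apply]
    split_ifs
    · exact S.algebraMap_mem r
    · exact zero_mem S
  star_mem' {M} hM i j := by
    rw [CStarMatrix.star_apply]
    exact star_mem (hM j i)

instance (S : StarSubalgebra ℂ A) [FiniteDimensional ℂ S] :
    FiniteDimensional ℂ (S.cstarMatrix k) := by
  let f : S.cstarMatrix k →ₗ[ℂ] k → k → S :=
    { toFun M i j := ⟨M.1 i j, M.2 i j⟩
      map_add' _ _ := rfl
      map_smul' _ _ := rfl }
  refine FiniteDimensional.of_injective f fun M N h => Subtype.ext (CStarMatrix.ext fun i j => ?_)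
  exact congrArg Subtype.val (congrFun (congrFun h i) j)

variable [PartialOrder A] [StarOrderedRing A]

/-- The topology on matrices is entrywise, so each entry can be approximated separately. The
finitely many approximants lie in a common `G n` by monotonicity. -/
theorem dense_finiteDimensionalElements_cstarMatrix {G : ℕ → StarSubalgebra ℂ A}
    (hmono : Monotone G) (hfin : ∀ n, FiniteDimensional ℂ (G n))
    (hG : Dense (⋃ n, (G n : Set A))) :
    Dense (finiteDimensionalElements (CStarMatrix k k A)) := by
  have h : Dense (Set.univ.pi fun _ : k => Set.univ.pi fun _ : k => ⋃ n, (G n : Set A)) :=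
    dense_pi _ fun _ _ => dense_pi _ fun _ _ => hG
  refine Dense.mono ?_ (show Dense (X := CStarMatrix k k A) _ from h)
  intro M hM
  have hM' : ∀ i j, ∃ n, M i j ∈ G n := fun i j => by
    simpa using hM i (Set.mem_univ i) j (Set.mem_univ j)
  choose N hN using hM'
  let n := Finset.univ.sup fun i => Finset.univ.sup fun j => N i j
  refine ⟨(G n).cstarMatrix k, inferInstance, fun i j => hmono ?_ (hN i j)⟩
  exact (Finset.le_sup (f := fun j => N i j) (Finset.mem_univ j)).trans
    (Finset.le_sup (f := fun i => Finset.univ.sup fun j => N i j) (Finset.mem_univ i))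

end CStarMatrix

theorem IsAFAlgebra.dense_finiteDimensionalElements {A : Type*} [NonUnitalCStarAlgebra A]
    [PartialOrder (Unitization ℂ A)] [StarOrderedRing (Unitization ℂ A)]
    (hA : IsAFAlgebra A) (k : Type*) [Fintype k] [DecidableEq k] :
    Dense (finiteDimensionalElements (CStarMatrix k k (Unitization ℂ A))) := by
  obtain ⟨F, hmono, hfin, hF⟩ := hA
  exact dense_finiteDimensionalElements_cstarMatrix (G := fun n => (F n).unitizationSubalgebra)
    (fun _ _ h _ hx => hmono h hx) (fun _ => inferInstance)
    (dense_iUnion_unitizationSubalgebra hF)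

/-! ### Projections in the kernel -/

section Kernel

variable {A B : Type*} [NonUnitalCStarAlgebra A] [NonUnitalCStarAlgebra B]

/-- The kernel of a non-injective *-homomorphism on an AF algebra contains a nonzero projection. -/
theorem IsAFAlgebra.exists_isStarProjection_map_eq_zero (hA : IsAFAlgebra A) (φ : A →⋆ₙₐ[ℂ] B)
    (hφ : ¬ Function.Injective φ) : ∃ p : A, IsStarProjection p ∧ p ≠ 0 ∧ φ p = 0 := by
  obtain ⟨F, -, hfin, hF⟩ := hA
  have hφc : Continuous φ :=
    (NonUnitalStarAlgHom.instContinuousLinearMapClassComplex).map_continuous φ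
  obtain ⟨a, ha, ha0⟩ : ∃ a, φ a = 0 ∧ a ≠ 0 := by
    simpa [injective_iff_map_eq_zero] using hφ
  let x : A := star a * a
  have hx0 : 0 < ‖x‖ := norm_pos_iff.2 (by simpa [x, CStarRing.star_mul_self_eq_zero_iff] using ha0)
  have hφx : φ x = 0 := by simp [x, ha]
  have hxs : star x = x := by simp [x]
  -- An approximant `b` of `x` within `δ` has `‖b‖ > 3δ` but `‖φ b‖ < δ`. Cutting the spectrum at
  -- `|t| = δ` therefore keeps something of `b` and nothing of `φ b`.
  set δ := ‖x‖ / 4 with hδ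
  obtain ⟨y, hy, hyx⟩ := Metric.dense_iff.1 hF x δ (by positivity)
  obtain ⟨n, hyn⟩ := Set.mem_iUnion.1 hyx
  let b : A := (2⁻¹ : ℂ) • (y + star y)
  have hbs : IsSelfAdjoint b := by
    refine IsSelfAdjoint.smul ?_ (IsSelfAdjoint.add_star_self y)
    simp [IsSelfAdjoint]
  have hbn : b ∈ F n := SMulMemClass.smul_mem _ (add_mem hyn (star_mem hyn))
  have hbx : ‖b - x‖ < δ := by
    have h1 : b - x = (2⁻¹ : ℂ) • ((y - x) + star (y - x)) := by
      have h2 : x = (2⁻¹ : ℂ) • (x + x) := by rw [← two_smul ℂ x, smul_smul]; norm_num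
      nth_rw 1 [h2]
      rw [← smul_sub, star_sub, hxs]
      congr 1
      abel
    have hx' : ‖y - x‖ < δ := by simpa [dist_eq_norm] using hy
    have := norm_add_le (y - x) (star (y - x))
    rw [norm_star] at this
    rw [h1, norm_smul, show ‖(2⁻¹ : ℂ)‖ = 1 / 2 by norm_num]
    linarith
  have hφb : ‖φ b‖ < δ := by
    have := NonUnitalStarAlgHom.norm_apply_le φ (b - x)
    rw [map_sub, hφx, sub_zero] at this
    linarith
  have hbf : (quasispectrum ℝ b).Finite := by
    rw [Unitization.quasispectrum_eq_spectrum_inr' ℝ ℂ b]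
    exact finite_spectrum_of_mem_finiteDimensionalElements
      ⟨(F n).unitizationSubalgebra, inferInstance, hbn⟩
  let f : ℝ → ℝ := fun t => if δ < |t| then 1 else 0
  -- Vanishing at 0 keeps the spectral projection in `A` itself rather than in `A~`.
  have hf0 : f 0 = 0 := if_neg (by rw [abs_zero]; linarith)
  have hf : ContinuousOn f (quasispectrum ℝ b) := hbf.continuousOn f
  refine ⟨cfcₙ f b, ⟨?_, cfcₙ_predicate f b⟩, fun h => ?_, ?_⟩
  · rw [IsIdempotentElem, ← cfcₙ_mul f f b]
    congr 1
    ext t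
    by_cases ht : δ < |t| <;> simp [f]
  · have hb2 : ‖b‖ ≤ δ := by
      rw [← cfcₙ_id' ℝ b]
      refine norm_cfcₙ_le fun t ht => ?_
      by_contra hlt
      have := norm_apply_le_norm_cfcₙ f b ht
      rw [h, norm_zero] at this
      have h1 : f t = 1 := if_pos (by simpa using hlt)
      rw [h1] at this
      norm_num at this
    have := norm_sub_norm_le x b
    rw [norm_sub_rev] at this
    linarith
  · rw [NonUnitalStarAlgHom.map_cfcₙ φ f b hf hf0 hφc hbs (hbs.map φ)]
    rw [← norm_le_zero_iff]
    refine norm_cfcₙ_le fun t ht => ?_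
    have : ‖t‖ ≤ ‖φ b‖ := NonUnitalIsometricContinuousFunctionalCalculus.norm_quasispectrum_le
      (φ b) ht (hbs.map φ)
    have h1 : f t = 0 := if_neg (by rw [Real.norm_eq_abs] at this; linarith)
    simp [h1]

end Kernel

/-! ### Vanishing classes and the two halves of the theorem -/

namespace KTheory

open Matrix

section Grothendieck

variable {R : Type*} [NonUnitalRing R] [StarRing R]

theorem K00.exists_eq_of_sub_of (x : K00 R) : ∃ p q : Proj R,
    x = Algebra.GrothendieckAddGroup.of (V.mk p) - Algebra.GrothendieckAddGroup.of (V.mk q) := by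
  induction x using AddLocalization.ind with
  | _ y =>
    obtain ⟨⟨p⟩, ⟨⟨q⟩, hq⟩⟩ := y
    refine ⟨p, q, ?_⟩
    rw [eq_sub_iff_add_eq, AddLocalization.mk_eq_addMonoidOf_mk']
    exact AddSubmonoid.LocalizationMap.mk'_spec _ _ _

/-- Cancellation may fail in `V R`, so vanishing in the group yields only a class absorbing `v`. -/
theorem K00.exists_add_eq_of_of_eq_zero {v : V R}
    (h : Algebra.GrothendieckAddGroup.of v = (0 : K00 R)) : ∃ w : V R, v + w = w := by
  rw [← map_zero (Algebra.GrothendieckAddGroup.of (M := V R))] at h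
  obtain ⟨c, hc⟩ := (AddSubmonoid.LocalizationMap.eq_iff_exists _).1 h
  exact ⟨c, by simpa [add_comm] using hc⟩

end Grothendieck

section StablyFinite

variable {R : Type*} [Ring R] [StarRing R]

/-- A projection whose class vanishes in `K₀₀` is zero if the matrix algebras are finite. -/
theorem Proj.mat_eq_zero_of_of_eq_zero
    (hR : ∀ (k : Type) [Fintype k] [DecidableEq k] (w : Matrix k k R), wᴴ * w = 1 → w * wᴴ = 1)
    (p : Proj R) (h : Algebra.GrothendieckAddGroup.of (V.mk p) = (0 : K00 R)) : p.mat = 0 := by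
  obtain ⟨⟨r⟩, hw⟩ := K00.exists_add_eq_of_of_eq_zero h
  have hpr : MvN (p.oplus r).mat r.mat := Quotient.exact hw
  have hp := p.isStarProjection
  have hr := r.isStarProjection
  have h₁ := isStarProjection_fromBlocks hp hr
  obtain ⟨v, hv₁, hv₂⟩ := (p.mvN_oplus r).trans h₁ hr hpr
  have hr2 : r.mat * r.mat = r.mat := hr.isIdempotentElem.eq
  have hrs : r.matᴴ = r.mat := hr.isSelfAdjoint.star_eq
  set P : Matrix (Fin p.size ⊕ Fin r.size) (Fin p.size ⊕ Fin r.size) R :=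
    fromBlocks p.mat 0 0 r.mat with hP
  have hPP : P * P = P := h₁.isIdempotentElem.eq
  have hPs : Pᴴ = P := h₁.isSelfAdjoint.star_eq
  -- `V` is a partial isometry from `p ⊕ r` to `0 ⊕ r`
  set V : Matrix (Fin p.size ⊕ Fin r.size) (Fin p.size ⊕ Fin r.size) R :=
    Matrix.fromRows 0 (r.mat * v * P) with hV
  set Q : Matrix (Fin p.size ⊕ Fin r.size) (Fin p.size ⊕ Fin r.size) R :=
    fromBlocks 0 0 0 r.mat with hQ
  have hVV : Vᴴ * V = P := by
    have : Vᴴ * V = (r.mat * v * P)ᴴ * (r.mat * v * P) := by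
      rw [hV, conjTranspose_fromRows_eq_fromCols_conjTranspose, fromCols_mul_fromRows]
      simp
    rw [this, conjTranspose_mul, conjTranspose_mul, hPs, hrs]
    calc P * (vᴴ * r.mat) * (r.mat * v * P)
        = P * (vᴴ * (r.mat * r.mat) * v) * P := by simp only [Matrix.mul_assoc]
      _ = P * ((vᴴ * v) * (vᴴ * v)) * P := by rw [hr2, hv₂]; simp only [Matrix.mul_assoc]
      _ = P := by rw [← hv₁, hPP, hPP, hPP]
  have hVV' : V * Vᴴ = Q := by
    have : r.mat * v * P * (r.mat * v * P)ᴴ = r.mat := by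
      rw [conjTranspose_mul, conjTranspose_mul, hPs, hrs]
      calc r.mat * v * P * (P * (vᴴ * r.mat))
          = r.mat * (v * (P * P) * vᴴ) * r.mat := by simp only [Matrix.mul_assoc]
        _ = r.mat * ((v * vᴴ) * (v * vᴴ)) * r.mat := by
            rw [hPP, hv₁]; simp only [Matrix.mul_assoc]
        _ = r.mat := by rw [← hv₂, hr2, hr2, hr2]
    rw [hV, conjTranspose_fromRows_eq_fromCols_conjTranspose, fromRows_mul_fromCols, this, hQ]
    simp
  -- In a general *-ring `v* v = P` does not force `v P = v`. The compression `r v P` in the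
  -- definition of `V` builds this in without changing the two products.
  have hVP : V * P = V := by
    rw [hV, fromRows_mul, Matrix.mul_assoc, hPP, Matrix.zero_mul]
  have hQV : Q * V = V := by
    rw [hV, hQ, fromBlocks_mul_fromRows]
    simp only [Matrix.mul_zero, Matrix.zero_mul, zero_add]
    rw [← Matrix.mul_assoc, ← Matrix.mul_assoc, hr2]
  have hPQ : P * Q = Q := by simp [hP, hQ, fromBlocks_multiply, hr2]
  have hPV : P * V = V := by rw [← hQV, ← Matrix.mul_assoc, hPQ]
  have hPV' : Vᴴ * P = Vᴴ := by simpa [hPs] using congrArg conjTranspose hPV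
  have hVP' : P * Vᴴ = Vᴴ := by simpa [hPs] using congrArg conjTranspose hVP
  -- `V` carries `P` onto `Q ≤ P`, so adding `1 - P` gives an isometry with range projection `Q + (1
  -- - P)`. Finiteness makes this 1, whence `P = Q` and the corner `p` vanishes.
  have hiso : (V + (1 - P))ᴴ * (V + (1 - P)) = 1 := by
    rw [conjTranspose_add, conjTranspose_sub, conjTranspose_one, hPs]
    simp only [Matrix.add_mul, Matrix.mul_add, Matrix.sub_mul, Matrix.mul_sub, Matrix.one_mul,
      Matrix.mul_one, hPP, hVV, hPV, hPV']
    abel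
  have hco := hR _ _ hiso
  rw [conjTranspose_add, conjTranspose_sub, conjTranspose_one, hPs] at hco
  simp only [Matrix.add_mul, Matrix.mul_add, Matrix.sub_mul, Matrix.mul_sub, Matrix.one_mul,
    Matrix.mul_one, hPP, hVV', hVP, hVP'] at hco
  have hPQ : P = Q := by
    have h1 : Q + (1 - P) = 1 := Eq.trans (by abel) hco
    rw [add_sub_left_comm, add_eq_left, sub_eq_zero] at h1
    exact h1.symm
  exact (fromBlocks_inj.1 hPQ).1

end StablyFinite

section CStarAlgebra

variable {A B : Type*} [NonUnitalCStarAlgebra A] [NonUnitalCStarAlgebra B]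

theorem isStablyFinite_unitization_of_isAFAlgebra (hA : IsAFAlgebra A) (k : Type*) [Fintype k]
    [DecidableEq k] (w : Matrix k k (Unitization ℂ A)) (hw : wᴴ * w = 1) : w * wᴴ = 1 := by
  -- The spectral order supplies the instances needed for the C*-structure on `CStarMatrix`.
  let _ : PartialOrder (Unitization ℂ A) := CStarAlgebra.spectralOrder _
  have _ : StarOrderedRing (Unitization ℂ A) := CStarAlgebra.spectralOrderedRing _
  exact mul_star_self_eq_one_of_dense_finiteDimensionalElements
    (D := CStarMatrix k k (Unitization ℂ A)) (hA.dense_finiteDimensionalElements k) hw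

/-- If `A` is AF and `φ : A → B` is surjective, then every projection over `B~` is equivalent to
the image of a projection over `A~`. -/
theorem exists_proj_map_starMap (hA : IsAFAlgebra A) {φ : A →⋆ₙₐ[ℂ] B}
    (hφ : Function.Surjective φ) (q : Proj (Unitization ℂ B)) :
    ∃ p : Proj (Unitization ℂ A), V.map (Unitization.starMap φ) (V.mk p) = V.mk q := by
  let _ : PartialOrder (Unitization ℂ A) := CStarAlgebra.spectralOrder _
  have _ : StarOrderedRing (Unitization ℂ A) := CStarAlgebra.spectralOrderedRing _
  let _ : PartialOrder (Unitization ℂ B) := CStarAlgebra.spectralOrder _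
  have _ : StarOrderedRing (Unitization ℂ B) := CStarAlgebra.spectralOrderedRing _
  have hsurj := Unitization.starMap_surjective hφ
  let ψ₀ := CStarMatrix.mapₙₐ (n := Fin q.size)
    (Unitization.starMap φ : Unitization ℂ A →⋆ₙₐ[ℂ] Unitization ℂ B)
  let ψ : CStarMatrix (Fin q.size) (Fin q.size) (Unitization ℂ A) →⋆ₐ[ℂ]
      CStarMatrix (Fin q.size) (Fin q.size) (Unitization ℂ B) :=
    { toFun := ψ₀
      map_one' := by
        refine CStarMatrix.ext fun i j => ?_
        change Unitization.starMap φ ((1 : Matrix _ _ (Unitization ℂ A)) i j) =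
          (1 : Matrix _ _ (Unitization ℂ B)) i j
        rw [Matrix.one_apply, Matrix.one_apply]
        split_ifs <;> simp
      map_mul' := map_mul ψ₀
      map_zero' := map_zero ψ₀
      map_add' := map_add ψ₀
      commutes' r := by
        refine CStarMatrix.ext fun i j => ?_
        change Unitization.starMap φ (algebraMap ℂ (CStarMatrix _ _ (Unitization ℂ A)) r i j) = _
        rw [CStarMatrix.algebraMap_apply, CStarMatrix.algebraMap_apply]
        split_ifs
        · exact AlgHomClass.commutes (Unitization.starMap φ) r
        · exact map_zero (Unitization.starMap φ)
      map_star' := map_star ψ₀ }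
  have hψ : Function.Surjective ψ := fun M => by
    choose g hg using hsurj
    exact ⟨CStarMatrix.ofMatrix fun i j => g (M i j), CStarMatrix.ext fun i j => hg _⟩
  obtain ⟨p, hp, v, hv⟩ := exists_isStarProjection_map_equiv
    (hA.dense_finiteDimensionalElements (Fin q.size)) ψ hψ
    (q := CStarMatrix.ofMatrix q.mat) ⟨q.isStarProjection.1, q.isStarProjection.2⟩
  exact ⟨⟨q.size, p, ⟨hp.1, hp.2⟩⟩, V.sound ⟨v, hv⟩⟩

theorem K0.map_surjective (hA : IsAFAlgebra A) {φ : A →⋆ₙₐ[ℂ] B}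
    (hφ : Function.Surjective φ) : Function.Surjective (K0.map φ) := by
  rintro ⟨x, hx⟩
  obtain ⟨p, q, rfl⟩ := K00.exists_eq_of_sub_of x
  obtain ⟨p', hp'⟩ := exists_proj_map_starMap hA hφ p
  obtain ⟨q', hq'⟩ := exists_proj_map_starMap hA hφ q
  have hmap : K00.map (Unitization.starMap φ) (Algebra.GrothendieckAddGroup.of (V.mk p') -
      Algebra.GrothendieckAddGroup.of (V.mk q')) = Algebra.GrothendieckAddGroup.of (V.mk p) -
      Algebra.GrothendieckAddGroup.of (V.mk q) := by
    rw [map_sub, K00.map_of, K00.map_of, hp', hq']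
  refine ⟨⟨Algebra.GrothendieckAddGroup.of (V.mk p') -
    Algebra.GrothendieckAddGroup.of (V.mk q'), ?_⟩, Subtype.ext hmap⟩
  -- The lift lies in `K0 A` because `φ~` preserves the scalar part.
  rw [K0, AddMonoidHom.mem_ker, ← K00.map_comp_apply (Unitization.starMap φ) (scalarHom B)
    (scalarHom A) fun y => ?_, hmap]
  · exact hx
  · change (Unitization.starMap φ y).fst = y.fst
    induction y using Unitization.ind with
    | inl_add_inr r a => simp [Unitization.algebraMap_eq_inl]

theorem K0.mk_eq_zero (hA : IsAFAlgebra A) {p : Proj A} (hp : K0.mk p = 0) : p.mat = 0 := by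
  have h := Proj.mat_eq_zero_of_of_eq_zero
    (fun k _ _ => isStablyFinite_unitization_of_isAFAlgebra hA k) _ (congrArg Subtype.val hp)
  ext i j
  exact Unitization.inr_injective (R := ℂ) (congrFun (congrFun h i) j)

theorem K0.injective_of_map_injective (hA : IsAFAlgebra A) {φ : A →⋆ₙₐ[ℂ] B}
    (hφ : Function.Injective (K0.map φ)) : Function.Injective φ := by
  by_contra hni
  obtain ⟨e, he, he0, hφe⟩ := hA.exists_isStarProjection_map_eq_zero φ hni
  let p : Proj A :=
    { size := 1
      mat := Matrix.of fun _ _ => e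
      isStarProjection := by
        constructor
        · ext i j
          simpa [Matrix.mul_apply] using he.isIdempotentElem.eq
        · ext i j
          exact he.isSelfAdjoint.star_eq }
  refine he0 (congrFun (congrFun (K0.mk_eq_zero hA (p := p) (hφ ?_)) 0) 0)
  rw [K0.map_mk, map_zero]
  have h : V.mk ((p.map φ).map (Unitization.inrNonUnitalStarAlgHom ℂ B)) = 0 := by
    -- The empty `0 × 1` matrix identifies the zero `1 × 1` projection with the projection of size
    -- zero.
    refine V.sound ⟨0, ?_, ?_⟩
    · rw [Matrix.mul_zero]
      refine Matrix.ext fun i j => ?_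
      change Unitization.inr (φ e) = 0
      rw [hφe, Unitization.inr_zero]
    · exact Matrix.ext fun i => i.elim0
  apply Subtype.ext
  change Algebra.GrothendieckAddGroup.of _ = _
  rw [h, map_zero]
  rfl

end CStarAlgebra

end KTheory

theorem corollary4p3 {A B : Type*} [NonUnitalCStarAlgebra A] [NonUnitalCStarAlgebra B]
    (hA : IsAFAlgebra A) (φ : A →⋆ₙₐ[ℂ] B) :
    (Function.Injective (KTheory.K0.map φ) → Function.Injective φ) ∧
      (Function.Surjective φ → Function.Surjective (KTheory.K0.map φ)) :=
  ⟨KTheory.K0.injective_of_map_injective hA, KTheory.K0.map_surjective hA⟩
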